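/- Conventions. Let $n\ge 1$, $\hat g(\xi)=(2\pi)^{-n/2}\int_{\mathbb R^n} g(x)e^{-i\langle x,\xi\rangle}dx$, extended to $L^2(\mathbb R^n)$ as usual. For $\beta<0$ and $c>0$ let $$h(x)=\Gamma(-\tfrac{\beta}{2})\,(c^2+|x|^2)^{\beta/2},\qquad x\in\mathbb R^n,$$ and let $m=\max\{\lceil \beta/2\rceil,0\}$ (so $m=0$). Let $\hat h$ be the generalized Fourier transform of $h$: the (a.e. unique) measurable function, locally square integrable on $\mathbb R^n\setminus\{0\}$, such that for some integer $k\ge 0$ one has $\int h\,\hat\gamma=\int \hat h\,\gamma$ (with $\hat h\gamma$ integrable) for all Schwartz functions $\gamma$ with $\gamma(\xi)=O(|\xi|^{2k})$ as $\xi\to0$. The native space $\mathcal C_{h,m}(\mathbb R^n)$ consists of the continuous functions $f:\mathbb R^n\to\mathbb C$ for which there is a constant $C$ with $$\Big|\int f\varphi\Big|\le C\Big\{\iint h(x-y)\varphi(x)\overline{\varphi(y)}\,dx\,dy\Big\}^{1/2}$$ for all $\varphi\in C_c^\infty(\mathbb R^n)$ orthogonal to all polynomials of degree less than $m$. The $h$-norm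 of a square integrable $f$ is normalized as $$\|f\|_h=\Big\{\frac1{(2\pi)^{2n}}\int_{\mathbb R^n}\frac{|\hat f(\xi)|^2}{\hat h(\xi)}\,d\xi\Big\}^{1/2}.$$ For $\sigma>0$ let $E_\sigma$ be the space of all $f\in L^2(\mathbb R^n)$ with $\|f\|_{E_\sigma}:=\{\int|\hat f(\xi)|^2e^{|\xi|^2/\sigma}d\xi\}^{1/2}<\infty$. Theorem. Let $n\ge1$, $c>0$, $\sigma>0$, $\beta<0$, $|n+\beta|\ge1$ and $n+\beta+1\ge0$. Then every $f\in E_\sigma$ (after modification on a null set) lies in $\mathcal C_{h,m}(\mathbb R^n)$, and $$\|f\|_h\le 2^{-n-\frac{1+\beta}{4}}\,\pi^{-n-\frac14}\,c^{\frac{1-n-\beta}{4}}\Big[(\xi^*)^{\frac{n+\beta+1}{2}}e^{c\xi^*-\frac{(\xi^*)^2}{\sigma}}\Big]^{1/2}\|f\|_{E_\sigma},\qquad \xi^*=\frac{c\sigma+\sqrt{c^2\sigma^2+4\sigma(n+\beta+1)}}{4}.$$ -/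

import Mathlib

open MeasureTheory
open scoped FourierTransform SchwartzMap ENNReal RealInnerProductSpace

noncomputable section

namespace ShapeParameter

/-- The space `ℝⁿ` with its Euclidean norm. -/
abbrev Rn (n : ℕ) : Type := EuclideanSpace ℝ (Fin n)

/-! ### The Fourier transform with angular frequency and the symmetric normalization -/

/-- `ĝ(ξ) = (2π)^{-n/2} ∫ e^{-i⟨x,ξ⟩} g(x) dx`, for integrable `g`. -/
def angularFourier {n : ℕ} (g : Rn n → ℂ) (ξ : Rn n) : ℂ :=
  (((2 * Real.pi) ^ (-(n : ℝ) / 2) : ℝ) : ℂ) *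
    ∫ x, Complex.exp (-(Complex.I * ((⟪x, ξ⟫ : ℝ) : ℂ))) * g x

/-- The same Fourier transform on `L²(ℝⁿ)`, obtained by rescaling Mathlib's `𝓕` on `L²`, which is
the continuous extension of `g ↦ ∫ e^{-2πi⟨x,ξ⟩} g(x) dx`. -/
def angularFourierL2 {n : ℕ} (f : Lp ℂ 2 (volume : Measure (Rn n))) (ξ : Rn n) : ℂ :=
  (((2 * Real.pi) ^ (-(n : ℝ) / 2) : ℝ) : ℂ) *
    ((𝓕 f : Lp ℂ 2 (volume : Measure (Rn n))) : Rn n → ℂ) ((2 * Real.pi)⁻¹ • ξ)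

/-- `w` is a generalized Fourier transform of `h`: a measurable function, locally square
integrable off the origin, with `∫ h γ̂ = ∫ w γ` for all Schwartz functions `γ` that are
`O(|ξ|^{2m})` at the origin, for some `m`. It is unique up to null sets (if `n ≥ 1`). -/
def IsGeneralizedFourier {n : ℕ} (h w : Rn n → ℝ) : Prop :=
  Measurable w ∧
  (∀ K : Set (Rn n), IsCompact K → (0 : Rn n) ∉ K → MemLp w 2 (volume.restrict K)) ∧
  ∃ m : ℕ, ∀ γ : 𝓢(Rn n, ℂ),
    ((fun ξ => γ ξ) =O[nhds 0] fun ξ => ‖ξ‖ ^ (2 * m)) →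
      Integrable (fun ξ => (w ξ : ℂ) * γ ξ) ∧
      ∫ x, (h x : ℂ) * angularFourier (fun ξ => γ ξ) x = ∫ ξ, (w ξ : ℂ) * γ ξ

open Classical in
/-- The generalized Fourier transform `ĥ` (the zero function if there is none). -/
def generalizedFourier {n : ℕ} (h : Rn n → ℝ) : Rn n → ℝ :=
  if H : ∃ w, IsGeneralizedFourier h w then H.choose else 0

/-! ### The radial function and its native space -/

/-- `h(x) = Γ(-β/2) (c² + |x|²)^{β/2}`. -/
def multiquadric (n : ℕ) (β c : ℝ) (x : Rn n) : ℝ :=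
  Real.Gamma (-β / 2) * (c ^ 2 + ‖x‖ ^ 2) ^ (β / 2)

/-- The order `m = max {⌈β/2⌉, 0}` of conditional positive definiteness of `h`. -/
def cpdOrder (β : ℝ) : ℕ := ⌈β / 2⌉.toNat

/-- `D_m`: the smooth, compactly supported, complex-valued functions on `ℝⁿ` that are orthogonal
to all polynomials of degree less than `m`. -/
def momentTestFunctions (n m : ℕ) : Set (Rn n → ℂ) :=
  {φ | ContDiff ℝ (⊤ : ℕ∞) φ ∧ HasCompactSupport φ ∧
    ∀ α : Fin n → ℕ, ∑ i, α i < m → ∫ x, ((∏ i, x i ^ α i : ℝ) : ℂ) * φ x = 0}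

/-- The quadratic form `∬ h(x - y) φ(x) conj (φ(y)) dx dy`. -/
def kernelForm {n : ℕ} (h : Rn n → ℝ) (φ : Rn n → ℂ) : ℂ :=
  ∫ x, ∫ y, (h (x - y) : ℂ) * φ x * (starRingEnd ℂ) (φ y)

/-- The native space `C_{h,m}(ℝⁿ)`: the continuous functions `f` such that, for some constant `C`,
`|∫ f φ| ≤ C {∬ h(x - y) φ(x) conj (φ(y)) dx dy}^{1/2}` for all `φ ∈ D_m`. -/
def nativeSpace {n : ℕ} (h : Rn n → ℝ) (m : ℕ) : Set (Rn n → ℂ) :=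
  {f | Continuous f ∧ ∃ C : ℝ, ∀ φ ∈ momentTestFunctions n m,
    ‖∫ x, f x * φ x‖ ≤ C * Real.sqrt (kernelForm h φ).re}

/-- The `h`-norm of a square integrable function,
`‖f‖_h = {(2π)^{-2n} ∫ |f̂(ξ)|² / ĥ(ξ) dξ}^{1/2}`, as an extended nonnegative number. -/
def hNorm {n : ℕ} (h : Rn n → ℝ) (f : Lp ℂ 2 (volume : Measure (Rn n))) : ℝ≥0∞ :=
  (ENNReal.ofReal (((2 * Real.pi) ^ (2 * n))⁻¹) *
    ∫⁻ ξ, ‖angularFourierL2 f ξ‖ₑ ^ 2 / ENNReal.ofReal (generalizedFourier h ξ)) ^ (1 / 2 : ℝ)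

/-! ### The Gaussian-type space -/

/-- `‖f‖_{E_σ} = {∫ |f̂(ξ)|² e^{|ξ|²/σ} dξ}^{1/2}`, as an extended nonnegative number. -/
def gaussNorm {n : ℕ} (σ : ℝ) (f : Lp ℂ 2 (volume : Measure (Rn n))) : ℝ≥0∞ :=
  (∫⁻ ξ, ‖angularFourierL2 f ξ‖ₑ ^ 2 * ENNReal.ofReal (Real.exp (‖ξ‖ ^ 2 / σ))) ^ (1 / 2 : ℝ)

/-- `E_σ = {f ∈ L²(ℝⁿ) : ∫ |f̂(ξ)|² e^{|ξ|²/σ} dξ < ∞}`. -/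
def gaussSpace (n : ℕ) (σ : ℝ) : Set (Lp ℂ 2 (volume : Measure (Rn n))) :=
  {f | ∫⁻ ξ, ‖angularFourierL2 f ξ‖ₑ ^ 2 * ENNReal.ofReal (Real.exp (‖ξ‖ ^ 2 / σ)) < ⊤}

/-- `ξ* = (cσ + √(c²σ² + 4σ(n + β + 1))) / 4`. -/
def xiStar (n : ℕ) (β c σ : ℝ) : ℝ :=
  (c * σ + Real.sqrt (c ^ 2 * σ ^ 2 + 4 * σ * ((n : ℝ) + β + 1))) / 4

end ShapeParameter

end

noncomputable section

namespace ShapeParameter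

/-! ### Maximizing `r ^ a * exp (c r - r² / σ)` -/

/-! Since `β < 0`, the Gamma integral writes `h` as a positive mixture of the Gaussians `exp
(-t|x|²)` with density `t^(-β/2-1) exp (-c²t)`. Transforming under the integral gives `ĥ` as the
positive, integrable function `multiquadricFourier`, a modified Bessel function `K_p` with `p =
-(n+β)/2` up to elementary factors. Test functions supported off the origin determine a generalized
transform almost everywhere, so the chosen `ĥ` agrees with it
(`generalizedFourier_multiquadric_ae_eq`).

Norm bound: for `|p| ≥ 1/2` one has `K_p(z) ≥ K_{1/2}(z) = √(π/(2z)) e^{-z}`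
(`le_lintegral_besselIntegrand`). Hence `exp (-r²/σ) / ĥ`, with `r = |ξ|`, is at most a constant
times `r^((n+β+1)/2) exp (cr - r²/σ)`, whose maximum is at `ξ*`. Integrating this pointwise bound
against `|f̂|² exp (|ξ|²/σ)` gives the inequality.

Native space: the Gaussian weight makes `f̂` integrable, so `f` is almost everywhere its continuous
inverse transform. Moving the transform onto `φ` and applying Cauchy–Schwarz with weight `ĥ` bounds
`|∫ f φ|`; the factor containing `φ` is the kernel form by Parseval
(`lintegral_unitFrequencyFourier_mul`), the other is finite by the norm bound. -/

/-- Global maximality without calculus: `s ≤ exp (s - 1)` at `s = r / X` linearizes the logarithm of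
the power, and the critical point equation `hXeq` turns the remaining gap between exponents into the
square `(r - X)² / σ`. -/
theorem rpow_mul_exp_sub_sq_div_le {a c σ X r : ℝ} (ha : 0 ≤ a) (hσ : 0 < σ) (hX : 0 < X)
    (hXeq : 2 * X ^ 2 = c * σ * X + a * σ) (hr : 0 ≤ r) :
    r ^ a * Real.exp (c * r - r ^ 2 / σ) ≤ X ^ a * Real.exp (c * X - X ^ 2 / σ) := by
  have h1 : (r / X) ^ a ≤ Real.exp (a * (r / X - 1)) := by
    rw [mul_comm, Real.exp_mul]
    refine Real.rpow_le_rpow (by positivity) ?_ ha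
    linarith [Real.add_one_le_exp (r / X - 1)]
  have h2 : r ^ a = X ^ a * (r / X) ^ a := by
    rw [← Real.mul_rpow hX.le (by positivity), mul_div_cancel₀ _ hX.ne']
  have h3 : a * (r / X - 1) + (c * r - r ^ 2 / σ) ≤ c * X - X ^ 2 / σ := by
    have ha' : a = (2 * X ^ 2 - c * σ * X) / σ := by
      rw [eq_div_iff hσ.ne']; linarith
    have : c * X - X ^ 2 / σ - (a * (r / X - 1) + (c * r - r ^ 2 / σ)) = (r - X) ^ 2 / σ := by
      rw [ha']; field_simp; ring
    have h0 : 0 ≤ (r - X) ^ 2 / σ := by positivity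
    linarith
  calc r ^ a * Real.exp (c * r - r ^ 2 / σ)
      = X ^ a * ((r / X) ^ a * Real.exp (c * r - r ^ 2 / σ)) := by rw [h2]; ring
    _ ≤ X ^ a * (Real.exp (a * (r / X - 1)) * Real.exp (c * r - r ^ 2 / σ)) := by gcongr
    _ = X ^ a * Real.exp (a * (r / X - 1) + (c * r - r ^ 2 / σ)) := by rw [Real.exp_add]
    _ ≤ _ := by gcongr

theorem xiStar_pos {n : ℕ} {β c σ : ℝ} (hc : 0 < c) (hσ : 0 < σ) : 0 < xiStar n β c σ := by
  have := Real.sqrt_nonneg (c ^ 2 * σ ^ 2 + 4 * σ * ((n : ℝ) + β + 1))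
  unfold xiStar
  positivity

/-- This is `a / X + c - 2X / σ = 0`, the vanishing of the logarithmic derivative, for `a = (n + β +
1) / 2`. -/
theorem two_mul_xiStar_sq {n : ℕ} {β c σ : ℝ} (hσ : 0 < σ) (h : 0 ≤ (n : ℝ) + β + 1) :
    2 * xiStar n β c σ ^ 2 = c * σ * xiStar n β c σ + ((n : ℝ) + β + 1) / 2 * σ := by
  have := Real.sq_sqrt (show 0 ≤ c ^ 2 * σ ^ 2 + 4 * σ * ((n : ℝ) + β + 1) by positivity)
  unfold xiStar
  nlinarith

/-! ### A lower bound for the modified Bessel function `K_p` with `|p| ≥ 1/2` -/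

theorem image_mul_exp_two_arsinh {τ : ℝ} (hτ : 0 < τ) :
    (fun v => τ * Real.exp (2 * Real.arsinh v)) '' Set.univ = Set.Ioi 0 := by
  ext t
  simp only [Set.image_univ, Set.mem_range, Set.mem_Ioi]
  constructor
  · rintro ⟨v, rfl⟩
    positivity
  · intro ht
    refine ⟨Real.sinh (Real.log (t / τ) / 2), ?_⟩
    rw [Real.arsinh_sinh, mul_div_cancel₀ _ two_ne_zero, Real.exp_log (by positivity),
      mul_div_cancel₀ _ hτ.ne']

theorem cosh_two_mul_arsinh (v : ℝ) : Real.cosh (2 * Real.arsinh v) = 1 + 2 * v ^ 2 := by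
  rw [Real.cosh_two_mul, Real.cosh_sq, Real.sinh_arsinh]; ring

/-- The comparison `K_p ≥ K_{1/2}` rests on this: the left side is `cosh (arsinh v)`, and `|2p| ≥
1`. -/
theorem sqrt_le_cosh_arsinh {p : ℝ} (hp : 1 / 2 ≤ |p|) (v : ℝ) :
    √(1 + v ^ 2) ≤ Real.cosh (2 * p * Real.arsinh v) := by
  rw [← Real.cosh_arsinh, Real.cosh_le_cosh, abs_mul, abs_mul, abs_two]
  nlinarith [abs_nonneg (Real.arsinh v)]

/-- The scale `r / (2c)` balances `c²t` against `r²/(4t)`: for `t = (r / (2c)) e^{2u}` their sum is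
`cr cosh 2u = cr (1 + 2 sinh² u)`, a Gaussian exponent in `v = sinh u`. The factor `2 / √(1 + v²)`
is the derivative of `2 arsinh v`. -/
theorem deriv_mul_besselIntegrand {c r p v : ℝ} (hc : 0 < c) (hr : 0 < r) :
    let t := r / (2 * c) * Real.exp (2 * Real.arsinh v)
    t * (2 * (√(1 + v ^ 2))⁻¹) * (t ^ (p - 1) * Real.exp (-(t * c ^ 2 + r ^ 2 / (4 * t)))) =
      (r / (2 * c)) ^ p * (2 * (√(1 + v ^ 2))⁻¹) * Real.exp (2 * p * Real.arsinh v) *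
        (Real.exp (-(c * r)) * Real.exp (-(2 * (c * r)) * v ^ 2)) := by
  intro t
  have ht : 0 < t := by positivity
  have e1 : t * t ^ (p - 1) = (r / (2 * c)) ^ p * Real.exp (2 * p * Real.arsinh v) := by
    rw [Real.rpow_sub_one ht.ne', mul_div_cancel₀ _ ht.ne',
      Real.mul_rpow (by positivity) (Real.exp_pos _).le, ← Real.exp_mul, mul_right_comm 2 p]
  have e2 : t * c ^ 2 + r ^ 2 / (4 * t) = c * r * (1 + 2 * v ^ 2) := by
    rw [← cosh_two_mul_arsinh, Real.cosh_eq, Real.exp_neg]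
    simp only [t]
    have := Real.exp_pos (2 * Real.arsinh v)
    field_simp
    ring
  rw [e2, ← Real.exp_add]
  have e3 : -(c * r * (1 + 2 * v ^ 2)) = -(c * r) + -(2 * (c * r)) * v ^ 2 := by ring
  rw [e3]
  linear_combination (2 * (√(1 + v ^ 2))⁻¹) *
    Real.exp (-(c * r) + -(2 * (c * r)) * v ^ 2) * e1

theorem le_lintegral_besselIntegrand {c r p : ℝ} (hc : 0 < c) (hr : 0 < r) (hp : 1 / 2 ≤ |p|) :
    ENNReal.ofReal ((r / (2 * c)) ^ p * √(2 * Real.pi / (c * r)) * Real.exp (-(c * r))) ≤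
      ∫⁻ t in Set.Ioi (0 : ℝ),
        ENNReal.ofReal (t ^ (p - 1) * Real.exp (-(t * c ^ 2 + r ^ 2 / (4 * t)))) := by
  have hτ : 0 < r / (2 * c) := by positivity
  set τ := r / (2 * c) with hτdef
  set G : ℝ → ℝ := fun v => τ ^ p * (2 * (√(1 + v ^ 2))⁻¹) *
    Real.exp (2 * p * Real.arsinh v) * (Real.exp (-(c * r)) * Real.exp (-(2 * (c * r)) * v ^ 2))
    with hG
  have hGm : Measurable fun v => ENNReal.ofReal (G v) := by
    have := Real.continuous_arsinh.measurable
    fun_prop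
  have hG0 : ∀ v, 0 ≤ G v := fun v => by positivity
  have hsubst : ∫⁻ t in Set.Ioi (0 : ℝ),
        ENNReal.ofReal (t ^ (p - 1) * Real.exp (-(t * c ^ 2 + r ^ 2 / (4 * t)))) =
      ∫⁻ v, ENNReal.ofReal (G v) := by
    rw [← image_mul_exp_two_arsinh hτ,
      lintegral_image_eq_lintegral_abs_deriv_mul (s := Set.univ) MeasurableSet.univ
        (f' := fun v => τ * Real.exp (2 * Real.arsinh v) * (2 * (√(1 + v ^ 2))⁻¹)),
      Measure.restrict_univ]
    · refine lintegral_congr fun v => ?_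
      rw [abs_of_nonneg (by positivity), ← ENNReal.ofReal_mul (by positivity),
        deriv_mul_besselIntegrand hc hr]
    · intro v _
      have := (((Real.hasDerivAt_arsinh v).const_mul 2).exp.const_mul τ).hasDerivWithinAt
        (s := Set.univ)
      refine this.congr_deriv ?_
      ring
    · intro u _ v _ huv
      have := Real.exp_injective (mul_left_cancel₀ hτ.ne' huv)
      exact Real.arsinh_injective (by linarith)
  have hint : Integrable fun v : ℝ => Real.exp (-(2 * (c * r)) * v ^ 2) :=
    integrable_exp_neg_mul_sq (by positivity)
  -- Adding the values at `v` and `-v` replaces the exponential in `p` by a hyperbolic cosine, which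
  -- dominates the Jacobian's `√(1 + v²)` for either sign of `p`; a pure Gaussian remains.
  have hle : ∀ v, 4 * τ ^ p * Real.exp (-(c * r)) * Real.exp (-(2 * (c * r)) * v ^ 2) ≤
      G v + G (-v) := by
    intro v
    have hs : 0 < √(1 + v ^ 2) := by positivity
    have hcosh : Real.exp (2 * p * Real.arsinh v) + Real.exp (-(2 * p * Real.arsinh v)) =
        2 * Real.cosh (2 * p * Real.arsinh v) := by rw [Real.cosh_eq]; ring
    have hsum : G v + G (-v) = 4 * τ ^ p * Real.exp (-(c * r)) *
        Real.exp (-(2 * (c * r)) * v ^ 2) *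
          ((√(1 + v ^ 2))⁻¹ * Real.cosh (2 * p * Real.arsinh v)) := by
      simp only [hG, Real.arsinh_neg, neg_sq, mul_neg]
      linear_combination τ ^ p * (2 * (√(1 + v ^ 2))⁻¹) *
        (Real.exp (-(c * r)) * Real.exp (-(2 * (c * r)) * v ^ 2)) * hcosh
    rw [hsum]
    refine le_mul_of_one_le_right (by positivity) ?_
    rw [inv_mul_eq_div, one_le_div hs]
    exact sqrt_le_cosh_arsinh hp v
  have h2 : ENNReal.ofReal (4 * τ ^ p * Real.exp (-(c * r)) * √(Real.pi / (2 * (c * r)))) ≤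
      2 * ∫⁻ v, ENNReal.ofReal (G v) := by
    calc _ = ∫⁻ v, ENNReal.ofReal
          (4 * τ ^ p * Real.exp (-(c * r)) * Real.exp (-(2 * (c * r)) * v ^ 2)) := by
          rw [← ofReal_integral_eq_lintegral_ofReal (hint.const_mul _)
            (Filter.Eventually.of_forall fun v => by positivity), integral_const_mul,
            integral_gaussian]
      _ ≤ ∫⁻ v, (ENNReal.ofReal (G v) + ENNReal.ofReal (G (-v))) := by
          refine lintegral_mono fun v => ?_
          rw [← ENNReal.ofReal_add (hG0 _) (hG0 _)]
          exact ENNReal.ofReal_le_ofReal (hle v)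
      _ = _ := by
          rw [lintegral_add_left hGm, lintegral_neg_eq_self (fun v => ENNReal.ofReal (G v)),
            two_mul]
  have h3 : 4 * τ ^ p * Real.exp (-(c * r)) * √(Real.pi / (2 * (c * r))) =
      2 * (τ ^ p * √(2 * Real.pi / (c * r)) * Real.exp (-(c * r))) := by
    have : 2 * Real.pi / (c * r) = 2 ^ 2 * (Real.pi / (2 * (c * r))) := by field_simp
    rw [this, Real.sqrt_mul (by positivity), Real.sqrt_sq (by positivity)]
    ring
  rw [h3, ENNReal.ofReal_mul (by positivity), ENNReal.ofReal_ofNat] at h2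
  rw [hsubst]
  exact (ENNReal.mul_le_mul_iff_right two_ne_zero ENNReal.ofNat_ne_top).1 h2

/-! ### The Fourier transform of the multiquadric as a mixture of Gaussians -/

/-- The density in `t` of the Gaussian mixture giving the Fourier transform of the multiquadric. -/
def gaussianMixture (n : ℕ) (β c : ℝ) (ξ : Rn n) (t : ℝ) : ℝ :=
  2 ^ (-(n : ℝ) / 2) *
    (t ^ (-((n : ℝ) + β) / 2 - 1) * Real.exp (-(t * c ^ 2 + ‖ξ‖ ^ 2 / (4 * t))))

/-- The Fourier transform of the multiquadric, as an integral over Gaussians. -/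
def multiquadricFourier (n : ℕ) (β c : ℝ) (ξ : Rn n) : ℝ :=
  ∫ t in Set.Ioi (0 : ℝ), gaussianMixture n β c ξ t

variable {n : ℕ} {β c σ : ℝ}

theorem measurable_gaussianMixture :
    Measurable fun p : Rn n × ℝ => gaussianMixture n β c p.1 p.2 := by
  unfold gaussianMixture
  fun_prop

theorem gaussianMixture_nonneg (ξ : Rn n) {t : ℝ} (ht : 0 < t) :
    0 ≤ gaussianMixture n β c ξ t := by
  unfold gaussianMixture
  positivity

theorem gaussianMixture_eq (ξ : Rn n) (t : ℝ) :
    gaussianMixture n β c ξ t =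
      2 ^ (-(n : ℝ) / 2) * t ^ (-((n : ℝ) + β) / 2 - 1) * Real.exp (-(t * c ^ 2)) *
        Real.exp (-(4 * t)⁻¹ * ‖ξ‖ ^ 2) := by
  have h : -(t * c ^ 2 + ‖ξ‖ ^ 2 / (4 * t)) = -(t * c ^ 2) + -(4 * t)⁻¹ * ‖ξ‖ ^ 2 := by ring
  rw [gaussianMixture, h, Real.exp_add]
  ring

theorem gaussianMixture_const_mul_pi_rpow {t : ℝ} (ht : 0 < t) :
    2 ^ (-(n : ℝ) / 2) * t ^ (-((n : ℝ) + β) / 2 - 1) * (Real.pi / (4 * t)⁻¹) ^ ((n : ℝ) / 2) =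
      (2 * Real.pi) ^ ((n : ℝ) / 2) * t ^ (-β / 2 - 1) := by
  have h4 : (4 : ℝ) ^ ((n : ℝ) / 2) = 2 ^ ((n : ℝ) / 2) * 2 ^ ((n : ℝ) / 2) := by
    rw [← Real.mul_rpow (by norm_num) (by norm_num)]; norm_num
  have h2 : (2 : ℝ) ^ (-(n : ℝ) / 2) * 2 ^ ((n : ℝ) / 2) = 1 := by
    rw [← Real.rpow_add two_pos, neg_div, neg_add_cancel, Real.rpow_zero]
  have ht' : t ^ (-((n : ℝ) + β) / 2 - 1) * t ^ ((n : ℝ) / 2) = t ^ (-β / 2 - 1) := by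
    rw [← Real.rpow_add ht]; ring_nf
  rw [div_inv_eq_mul, Real.mul_rpow Real.pi_pos.le (by positivity),
    Real.mul_rpow (by norm_num) ht.le, h4, Real.mul_rpow two_pos.le Real.pi_pos.le, ← ht']
  linear_combination t ^ (-((n : ℝ) + β) / 2 - 1) * t ^ ((n : ℝ) / 2) *
    Real.pi ^ ((n : ℝ) / 2) * 2 ^ ((n : ℝ) / 2) * h2

theorem integrable_gaussianMixture_left {t : ℝ} (ht : 0 < t) :
    Integrable fun ξ : Rn n => gaussianMixture n β c ξ t := by
  simp_rw [gaussianMixture_eq]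
  refine Integrable.const_mul ?_ _
  have := GaussianFourier.integrable_cexp_neg_mul_sq_norm_add (V := Rn n)
    (b := (((4 * t)⁻¹ : ℝ) : ℂ)) (by rw [Complex.ofReal_re]; positivity) 0 0
  refine this.norm.congr (Filter.Eventually.of_forall fun ξ => ?_)
  simp only [Complex.norm_exp]
  norm_cast
  simp

theorem integral_gaussianMixture_left {t : ℝ} (ht : 0 < t) :
    ∫ ξ : Rn n, gaussianMixture n β c ξ t =
      (2 * Real.pi) ^ ((n : ℝ) / 2) * (t ^ (-β / 2 - 1) * Real.exp (-(c ^ 2 * t))) := by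
  simp_rw [gaussianMixture_eq]
  rw [integral_const_mul, GaussianFourier.integral_rexp_neg_mul_sq_norm (by positivity),
    finrank_euclideanSpace_fin, ← mul_assoc _ (t ^ (-β / 2 - 1)),
    ← gaussianMixture_const_mul_pi_rpow ht, mul_comm t]
  ring

theorem fourierInv_gaussianMixture {t : ℝ} (ht : 0 < t) (y : Rn n) :
    𝓕⁻ (fun ξ : Rn n => (gaussianMixture n β c ξ t : ℂ)) y =
      (((2 * Real.pi) ^ ((n : ℝ) / 2) *
        (t ^ (-β / 2 - 1) * Real.exp (-((c ^ 2 + ‖(2 * Real.pi) • y‖ ^ 2) * t))) : ℝ) : ℂ) := by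
  have hg := fourier_gaussian_innerProductSpace (V := Rn n)
    (b := (((4 * t)⁻¹ : ℝ) : ℂ)) (by rw [Complex.ofReal_re]; positivity) (-y)
  have hk : (fun ξ : Rn n => (gaussianMixture n β c ξ t : ℂ)) =
      ((2 ^ (-(n : ℝ) / 2) * t ^ (-((n : ℝ) + β) / 2 - 1) * Real.exp (-(t * c ^ 2)) : ℝ) : ℂ) •
        fun ξ : Rn n => Complex.exp (-(((4 * t)⁻¹ : ℝ) : ℂ) * (‖ξ‖ : ℂ) ^ 2) := by
    ext ξ
    rw [gaussianMixture_eq]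
    simp
  have hpow : ((Real.pi : ℂ) / (((4 * t)⁻¹ : ℝ) : ℂ)) ^ ((n : ℂ) / 2) =
      (((Real.pi / (4 * t)⁻¹) ^ ((n : ℝ) / 2) : ℝ) : ℂ) := by
    rw [Complex.ofReal_cpow (by positivity)]
    push_cast
    rfl
  have hexp : Complex.exp (-(Real.pi : ℂ) ^ 2 * (‖-y‖ : ℂ) ^ 2 / (((4 * t)⁻¹ : ℝ) : ℂ)) =
      (Real.exp (-(‖(2 * Real.pi) • y‖ ^ 2 * t)) : ℂ) := by
    rw [Complex.ofReal_exp, norm_smul, norm_neg, Real.norm_of_nonneg (by positivity)]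
    congr 1
    push_cast
    field_simp
    ring
  have hsmul (a : ℂ) (g : Rn n → ℂ) : 𝓕 (a • g) (-y) = a • 𝓕 g (-y) :=
    congrFun (VectorFourier.fourierIntegral_const_smul _ _ _ _ _) _
  have hsum : -((c ^ 2 + ‖(2 * Real.pi) • y‖ ^ 2) * t) =
      -(t * c ^ 2) + -(‖(2 * Real.pi) • y‖ ^ 2 * t) := by ring
  rw [Real.fourierInv_eq_fourier_neg, hk, hsmul, hg,
    finrank_euclideanSpace_fin, hpow, hexp, smul_eq_mul, ← Complex.ofReal_mul,
    ← Complex.ofReal_mul, ← mul_assoc _ (t ^ (-β / 2 - 1)), ← gaussianMixture_const_mul_pi_rpow ht,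
    hsum, Real.exp_add]
  congr 1
  ring

theorem integrable_rpow_mul_exp_neg {s a : ℝ} (hs : 0 < s) (ha : 0 < a) :
    IntegrableOn (fun t : ℝ => t ^ (s - 1) * Real.exp (-(a * t))) (Set.Ioi 0) := by
  have h := integrableOn_rpow_mul_exp_neg_mul_rpow (p := 1) (s := s - 1) (b := a)
    (by linarith) one_pos ha
  simpa using h

/-- By Tonelli, integrating in `ξ` first leaves a Gamma integrand of parameter `-β/2 > 0`. -/
theorem integrable_prod_gaussianMixture (hβ : β < 0) (hc : 0 < c) :
    Integrable (fun p : Rn n × ℝ => gaussianMixture n β c p.1 p.2)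
      (volume.prod (volume.restrict (Set.Ioi 0))) := by
  rw [integrable_prod_iff' measurable_gaussianMixture.aestronglyMeasurable]
  refine ⟨(ae_restrict_iff' measurableSet_Ioi).2 (Filter.Eventually.of_forall fun t ht =>
    integrable_gaussianMixture_left ht), ?_⟩
  refine (((integrable_rpow_mul_exp_neg (s := -β / 2) (a := c ^ 2) (by linarith)
    (by positivity)).const_mul ((2 * Real.pi) ^ ((n : ℝ) / 2)))).congr ?_
  refine (ae_restrict_iff' measurableSet_Ioi).2 (Filter.Eventually.of_forall fun t ht => ?_)
  simp only
  rw [← integral_gaussianMixture_left ht]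
  exact integral_congr_ae (Filter.Eventually.of_forall fun ξ =>
    (Real.norm_of_nonneg (gaussianMixture_nonneg ξ ht)).symm)

theorem integrable_multiquadricFourier (hβ : β < 0) (hc : 0 < c) :
    Integrable (multiquadricFourier n β c) :=
  (integrable_prod_gaussianMixture hβ hc).integral_prod_left

theorem measurable_multiquadricFourier : Measurable (multiquadricFourier n β c) :=
  (measurable_gaussianMixture.stronglyMeasurable.integral_prod_right
    (ν := volume.restrict (Set.Ioi 0))).measurable

theorem multiquadricFourier_nonneg (ξ : Rn n) : 0 ≤ multiquadricFourier n β c ξ :=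
  setIntegral_nonneg measurableSet_Ioi fun _ ht => gaussianMixture_nonneg ξ ht

theorem gaussianMixture_anti {ξ η : Rn n} (h : ‖ξ‖ ≤ ‖η‖) {t : ℝ} (ht : 0 < t) :
    gaussianMixture n β c η t ≤ gaussianMixture n β c ξ t := by
  unfold gaussianMixture
  gcongr

/-- Fubini gives integrability in `t` only for almost every frequency. Such frequencies are dense,
hence exist arbitrarily near the origin, and monotonicity in `‖ξ‖` then reaches every `ξ ≠ 0`. -/
theorem exists_norm_lt_integrableOn_gaussianMixture (hβ : β < 0) (hc : 0 < c) {δ : ℝ}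
    (hδ : 0 < δ) :
    ∃ η : Rn n, ‖η‖ < δ ∧ IntegrableOn (gaussianMixture n β c η) (Set.Ioi 0) := by
  have hd : Dense {η : Rn n | IntegrableOn (gaussianMixture n β c η) (Set.Ioi 0)} :=
    Measure.dense_of_ae (integrable_prod_gaussianMixture (n := n) hβ hc).prod_right_ae
  obtain ⟨η, hη, hball⟩ := hd.exists_mem_open (U := Metric.ball (0 : Rn n) δ)
    Metric.isOpen_ball ⟨0, Metric.mem_ball_self hδ⟩
  exact ⟨η, by simpa using hball, hη⟩

theorem integrableOn_gaussianMixture (hβ : β < 0) (hc : 0 < c) {ξ : Rn n} (hξ : ξ ≠ 0) :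
    IntegrableOn (gaussianMixture n β c ξ) (Set.Ioi 0) := by
  obtain ⟨η, hη, hint⟩ :=
    exists_norm_lt_integrableOn_gaussianMixture (n := n) hβ hc (norm_pos_iff.2 hξ)
  refine hint.mono' (measurable_gaussianMixture.comp measurable_prodMk_left).aestronglyMeasurable
    ((ae_restrict_iff' measurableSet_Ioi).2 (Filter.Eventually.of_forall fun t ht => ?_))
  rw [Real.norm_of_nonneg (gaussianMixture_nonneg ξ ht)]
  exact gaussianMixture_anti hη.le ht

theorem multiquadricFourier_anti (hβ : β < 0) (hc : 0 < c) {ξ η : Rn n} (hξ : ξ ≠ 0)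
    (h : ‖ξ‖ ≤ ‖η‖) : multiquadricFourier n β c η ≤ multiquadricFourier n β c ξ := by
  have hη : η ≠ 0 := norm_pos_iff.1 ((norm_pos_iff.2 hξ).trans_le h)
  exact setIntegral_mono_on (integrableOn_gaussianMixture hβ hc hη)
    (integrableOn_gaussianMixture hβ hc hξ) measurableSet_Ioi
    fun t ht => gaussianMixture_anti h ht

theorem memLp_multiquadricFourier (hβ : β < 0) (hc : 0 < c) {K : Set (Rn n)} (hK : IsCompact K)
    (h0 : (0 : Rn n) ∉ K) :
    MemLp (multiquadricFourier n β c) 2 (volume.restrict K) := by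
  rcases K.eq_empty_or_nonempty with rfl | hne
  · simp
  obtain ⟨ξ, hξK, hmin⟩ := hK.exists_isMinOn hne continuous_norm.continuousOn
  have hξ : ξ ≠ 0 := fun h => h0 (h ▸ hξK)
  have : IsFiniteMeasure (volume.restrict K) := ⟨by simpa using hK.measure_lt_top⟩
  refine MemLp.of_bound measurable_multiquadricFourier.aestronglyMeasurable
    (multiquadricFourier n β c ξ)
    ((ae_restrict_iff' hK.measurableSet).2 (Filter.Eventually.of_forall fun η hη => ?_))
  rw [Real.norm_of_nonneg (multiquadricFourier_nonneg η)]
  exact multiquadricFourier_anti hβ hc hξ (hmin hη)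

theorem fourierInv_multiquadricFourier (hβ : β < 0) (hc : 0 < c) (y : Rn n) :
    𝓕⁻ (fun ξ : Rn n => (multiquadricFourier n β c ξ : ℂ)) y =
      (((2 * Real.pi) ^ ((n : ℝ) / 2) * multiquadric n β c ((2 * Real.pi) • y) : ℝ) : ℂ) := by
  have hint := (integrable_prod_gaussianMixture (n := n) hβ hc).ofReal (𝕜 := ℂ)
  have hint' : Integrable (Function.uncurry fun (ξ : Rn n) (t : ℝ) =>
      Real.fourierChar ⟪ξ, y⟫ • (gaussianMixture n β c ξ t : ℂ))
      (volume.prod (volume.restrict (Set.Ioi 0))) := by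
    refine hint.mono ?_ (Filter.Eventually.of_forall fun p => ?_)
    · refine AEStronglyMeasurable.fun_smul (𝕜 := Circle) (Continuous.aestronglyMeasurable ?_) hint.1
      exact Real.continuous_fourierChar.comp (by fun_prop)
    · simp [Function.uncurry, Circle.norm_smul]
  have hgamma : ∫ t in Set.Ioi (0 : ℝ),
      t ^ (-β / 2 - 1) * Real.exp (-((c ^ 2 + ‖(2 * Real.pi) • y‖ ^ 2) * t)) =
        multiquadric n β c ((2 * Real.pi) • y) := by
    rw [Real.integral_rpow_mul_exp_neg_mul_Ioi (by linarith) (by positivity), multiquadric,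
      one_div, Real.inv_rpow (by positivity), ← Real.rpow_neg (by positivity),
      mul_comm (Real.Gamma _)]
    ring_nf
  calc 𝓕⁻ (fun ξ : Rn n => (multiquadricFourier n β c ξ : ℂ)) y
      = ∫ ξ : Rn n, ∫ t in Set.Ioi (0 : ℝ),
          Real.fourierChar ⟪ξ, y⟫ • (gaussianMixture n β c ξ t : ℂ) := by
        rw [Real.fourierInv_eq]
        refine integral_congr_ae (Filter.Eventually.of_forall fun ξ => ?_)
        simp only [multiquadricFourier, Circle.smul_def]
        rw [integral_smul]
        exact congrArg _ integral_ofReal.symm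
    _ = ∫ t in Set.Ioi (0 : ℝ), 𝓕⁻ (fun ξ : Rn n => (gaussianMixture n β c ξ t : ℂ)) y := by
        rw [integral_integral_swap hint']
        simp_rw [Real.fourierInv_eq]
    _ = ∫ t in Set.Ioi (0 : ℝ), (((2 * Real.pi) ^ ((n : ℝ) / 2) *
        (t ^ (-β / 2 - 1) * Real.exp (-((c ^ 2 + ‖(2 * Real.pi) • y‖ ^ 2) * t))) : ℝ) : ℂ) :=
        setIntegral_congr_fun measurableSet_Ioi fun t ht => fourierInv_gaussianMixture ht y
    _ = _ := by
        rw [← hgamma, ← integral_const_mul]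
        exact integral_ofReal

theorem le_multiquadricFourier (hβ : β < 0) (hc : 0 < c) (hnβ : 1 ≤ |(n : ℝ) + β|) {ξ : Rn n}
    (hξ : ξ ≠ 0) :
    2 ^ ((1 + β) / 2) * √Real.pi * c ^ (((n : ℝ) + β - 1) / 2) *
      ‖ξ‖ ^ (-((n : ℝ) + β + 1) / 2) * Real.exp (-(c * ‖ξ‖)) ≤ multiquadricFourier n β c ξ := by
  have hr : 0 < ‖ξ‖ := norm_pos_iff.2 hξ
  set r := ‖ξ‖ with hrdef
  set p : ℝ := -((n : ℝ) + β) / 2 with hp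
  have hp' : 1 / 2 ≤ |p| := by
    rw [hp, abs_div, abs_neg, abs_two]; linarith
  have h := le_lintegral_besselIntegrand hc hr hp'
  have hint := integrableOn_gaussianMixture hβ hc hξ
  have heq : gaussianMixture n β c ξ = fun t => 2 ^ (-(n : ℝ) / 2) *
      (t ^ (p - 1) * Real.exp (-(t * c ^ 2 + r ^ 2 / (4 * t)))) := rfl
  have hw : multiquadricFourier n β c ξ = 2 ^ (-(n : ℝ) / 2) * ∫ t in Set.Ioi (0 : ℝ),
      (t ^ (p - 1) * Real.exp (-(t * c ^ 2 + r ^ 2 / (4 * t)))) := by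
    rw [multiquadricFourier, heq, integral_const_mul]
  have hint' : IntegrableOn
      (fun t : ℝ => t ^ (p - 1) * Real.exp (-(t * c ^ 2 + r ^ 2 / (4 * t)))) (Set.Ioi 0) := by
    rw [heq] at hint
    exact (integrable_const_mul_iff (IsUnit.mk0 _ (by positivity)) _).1 hint
  have h0 : 0 ≤ᵐ[volume.restrict (Set.Ioi 0)]
      fun t : ℝ => t ^ (p - 1) * Real.exp (-(t * c ^ 2 + r ^ 2 / (4 * t))) :=
    (ae_restrict_iff' measurableSet_Ioi).2 (Filter.Eventually.of_forall fun t ht => by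
      have : 0 < t := ht
      simp only [Pi.zero_apply]
      positivity)
  rw [← ofReal_integral_eq_lintegral_ofReal hint' h0,
    ENNReal.ofReal_le_ofReal_iff (integral_nonneg_of_ae h0)] at h
  rw [hw]
  refine le_trans (le_of_eq ?_) (mul_le_mul_of_nonneg_left h (by positivity))
  have e2 : (2 : ℝ) ^ ((1 + β) / 2) = 2 ^ (-(n : ℝ) / 2) * 2 ^ (-p) * 2 ^ (1 / 2 : ℝ) := by
    rw [← Real.rpow_add two_pos, ← Real.rpow_add two_pos, hp]; ring_nf
  have ec : c ^ (((n : ℝ) + β - 1) / 2) = c ^ (-p) * c ^ (-(1 / 2) : ℝ) := by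
    rw [← Real.rpow_add hc, hp]; ring_nf
  have er : r ^ (-((n : ℝ) + β + 1) / 2) = r ^ p * r ^ (-(1 / 2) : ℝ) := by
    rw [← Real.rpow_add hr, hp]; ring_nf
  rw [e2, ec, er, Real.div_rpow hr.le (by positivity), Real.mul_rpow two_pos.le hc.le,
    Real.sqrt_div (by positivity), Real.sqrt_mul two_pos.le, Real.sqrt_mul hc.le,
    Real.rpow_neg two_pos.le, Real.rpow_neg hc.le, Real.rpow_neg hc.le, Real.rpow_neg hr.le]
  simp only [← Real.sqrt_eq_rpow]
  field_simp

/-! ### Fourier integrals -/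

section Fourier

variable {V : Type*} [NormedAddCommGroup V] [InnerProductSpace ℝ V] [FiniteDimensional ℝ V]
  [MeasurableSpace V] [BorelSpace V]

theorem integral_fourier_mul {f g : V → ℂ} (hf : Integrable f) (hg : Integrable g) :
    ∫ y, 𝓕 f y * g y = ∫ x, f x * 𝓕 g x := by
  have h := VectorFourier.integral_fourierIntegral_smul_eq_flip (e := Real.fourierChar)
    (μ := (volume : Measure V)) (ν := (volume : Measure V)) (L := innerₗ V)
    Real.continuous_fourierChar (by exact continuous_inner) hf hg
  rw [flip_innerₗ] at h
  exact h

theorem integral_fourierInv_mul {f g : V → ℂ} (hf : Integrable f) (hg : Integrable g) :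
    ∫ y, 𝓕⁻ f y * g y = ∫ x, f x * 𝓕⁻ g x := by
  have h := integral_fourier_mul hf.comp_neg hg
  rw [Real.fourierInv_eq_fourier_comp_neg f, h, ← integral_neg_eq_self]
  simp [Real.fourierInv_eq_fourier_neg]

theorem continuous_fourierInv {f : V → ℂ} (hf : Integrable f) : Continuous (𝓕⁻ f) :=
  VectorFourier.fourierIntegral_continuous Real.continuous_fourierChar
    (continuous_inner (𝕜 := ℝ) (E := V)).neg hf

theorem norm_fourierInv_le (f : V → ℂ) (v : V) : ‖𝓕⁻ f v‖ ≤ ∫ x, ‖f x‖ :=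
  VectorFourier.norm_fourierIntegral_le_integral_norm _ _ _ _ _

theorem fourier_conj (f : V → ℂ) (v : V) :
    𝓕 (fun x => (starRingEnd ℂ) (f x)) v = (starRingEnd ℂ) (𝓕⁻ f v) := by
  rw [Real.fourier_eq, Real.fourierInv_eq, ← integral_conj]
  refine integral_congr_ae (Filter.Eventually.of_forall fun x => ?_)
  simp only [Circle.smul_def, smul_eq_mul, map_mul, ← Circle.coe_inv_eq_conj,
    AddChar.map_neg_eq_inv]

theorem fourierInv_sub_eq_fourier (W : V → ℂ) (x y : V) :
    𝓕⁻ W (x - y) = 𝓕 (fun v => Real.fourierChar ⟪v, x⟫ • W v) y := by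
  rw [Real.fourier_eq, Real.fourierInv_eq]
  refine integral_congr_ae (Filter.Eventually.of_forall fun v => ?_)
  simp only
  rw [smul_smul, ← AddChar.map_add_eq_mul, inner_sub_right, neg_add_eq_sub]

/-- The quadratic form of a kernel whose Fourier transform `W` is integrable. -/
theorem integral_integral_fourierInv_sub {W φ : V → ℂ} (hW : Integrable W) (hφ : Integrable φ) :
    ∫ x, ∫ y, 𝓕⁻ W (x - y) * φ x * (starRingEnd ℂ) (φ y) =
      ∫ v, W v * (‖𝓕⁻ φ v‖ ^ 2 : ℝ) := by
  have hφc : Integrable fun y => (starRingEnd ℂ) (φ y) :=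
    hφ.mono (Complex.continuous_conj.comp_aestronglyMeasurable hφ.1)
      (Filter.Eventually.of_forall fun y => (RCLike.norm_conj _).le)
  have hbdd : Integrable fun v => W v * (starRingEnd ℂ) (𝓕⁻ φ v) := by
    refine hW.mul_bdd (c := ∫ x, ‖φ x‖)
      (Complex.continuous_conj.comp (continuous_fourierInv hφ)).aestronglyMeasurable
      (Filter.Eventually.of_forall fun v => ?_)
    rw [RCLike.norm_conj]
    exact norm_fourierInv_le φ v
  have hinner : ∀ x, ∫ y, 𝓕⁻ W (x - y) * φ x * (starRingEnd ℂ) (φ y) =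
      𝓕⁻ (fun v => W v * (starRingEnd ℂ) (𝓕⁻ φ v)) x * φ x := by
    intro x
    have hWx : Integrable fun v => Real.fourierChar ⟪v, x⟫ • W v := by
      refine hW.mono ?_ (Filter.Eventually.of_forall fun v => by simp [Circle.norm_smul])
      exact AEStronglyMeasurable.fun_smul (𝕜 := Circle) (Continuous.aestronglyMeasurable
        (Real.continuous_fourierChar.comp (by fun_prop))) hW.1
    calc ∫ y, 𝓕⁻ W (x - y) * φ x * (starRingEnd ℂ) (φ y)
        = φ x * ∫ y, 𝓕 (fun v => Real.fourierChar ⟪v, x⟫ • W v) y * (starRingEnd ℂ) (φ y) := by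
          rw [← integral_const_mul]
          refine integral_congr_ae (Filter.Eventually.of_forall fun y => ?_)
          simp only [fourierInv_sub_eq_fourier]
          ring
      _ = φ x * 𝓕⁻ (fun v => W v * (starRingEnd ℂ) (𝓕⁻ φ v)) x := by
          rw [integral_fourier_mul hWx hφc, Real.fourierInv_eq]
          congr 1
          refine integral_congr_ae (Filter.Eventually.of_forall fun v => ?_)
          simp only [fourier_conj, Circle.smul_def, smul_eq_mul, mul_assoc]
      _ = _ := mul_comm _ _
  simp_rw [hinner]
  rw [integral_fourierInv_mul hbdd hφ]
  refine integral_congr_ae (Filter.Eventually.of_forall fun v => ?_)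
  simp only
  rw [mul_assoc, mul_comm _ (𝓕⁻ φ v), Complex.mul_conj']
  push_cast
  rfl

/-- If the Fourier transform of an `L²` function is integrable, the inversion formula holds. -/
theorem ae_eq_fourierInv_of_integrable_fourier (f : Lp ℂ 2 (volume : Measure V))
    (hF : Integrable ((𝓕 f : Lp ℂ 2 (volume : Measure V)) : V → ℂ)) :
    (f : V → ℂ) =ᵐ[volume] 𝓕⁻ ((𝓕 f : Lp ℂ 2 (volume : Measure V)) : V → ℂ) := by
  refine ae_eq_of_integral_contDiff_smul_eq ((Lp.memLp f).locallyIntegrable one_le_two)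
    (continuous_fourierInv hF).locallyIntegrable fun g hg hgc => ?_
  have hg₁ : HasCompactSupport (Complex.ofRealCLM ∘ g) := hgc.comp_left rfl
  have hg₂ : ContDiff ℝ (⊤ : ℕ∞) (Complex.ofRealCLM ∘ g) := by fun_prop
  let γ : 𝓢(V, ℂ) := hg₁.toSchwartzMap hg₂
  have hγ : ∀ x, γ x = (g x : ℂ) := fun x => rfl
  -- For tempered distributions inversion holds by duality; integrability of `𝓕 f` then lets the
  -- multiplication formula move `𝓕⁻` from `γ` back onto it.
  have key : (f : 𝓢'(V, ℂ)) γ =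
      ((𝓕 f : Lp ℂ 2 (volume : Measure V)) : 𝓢'(V, ℂ)) (𝓕⁻ γ) := by
    have h := Lp.fourierInv_toTemperedDistribution_eq (𝓕 f)
    rw [FourierPair.fourierInv_fourier_eq] at h
    rw [← h, TemperedDistribution.fourierInv_apply]
  rw [Lp.toTemperedDistribution_apply, Lp.toTemperedDistribution_apply,
    SchwartzMap.fourierInv_coe] at key
  simp only [smul_eq_mul] at key
  rw [integral_fourierInv_mul γ.integrable hF] at key
  simpa only [hγ, Complex.real_smul] using key

theorem lintegral_comp_smul (f : V → ℝ≥0∞) {R : ℝ} (hR : R ≠ 0) :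
    ∫⁻ x, f (R • x) = ENNReal.ofReal |(R ^ Module.finrank ℝ V)⁻¹| * ∫⁻ x, f x := by
  have h := lintegral_map_equiv (μ := (volume : Measure V)) f
    (Homeomorph.smul (Units.mk0 R hR)).toMeasurableEquiv
  have h' := Measure.map_addHaar_smul (volume : Measure V) hR
  rw [← smul_eq_mul, ← lintegral_smul_measure, ← h']
  exact h.symm

/-- Cauchy–Schwarz for the splitting `F ψ = (F / √W) (√W ψ)`. -/
theorem enorm_integral_mul_le_of_weight {F ψ : V → ℂ} {W : V → ℝ}
    (hF : AEStronglyMeasurable F) (hψ : AEStronglyMeasurable ψ) (hW : Measurable W)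
    (hpos : ∀ᵐ v, 0 < W v) :
    ‖∫ v, F v * ψ v‖ₑ ≤ (∫⁻ v, ‖F v‖ₑ ^ 2 / ENNReal.ofReal (W v)) ^ (1 / 2 : ℝ) *
      (∫⁻ v, ENNReal.ofReal (W v) * ‖ψ v‖ₑ ^ 2) ^ (1 / 2 : ℝ) := by
  have hsq : ∀ᵐ v, ENNReal.ofReal √(W v) ^ 2 = ENNReal.ofReal (W v) := by
    filter_upwards [hpos] with v hv
    rw [← ENNReal.ofReal_pow (Real.sqrt_nonneg _), Real.sq_sqrt hv.le]
  have hm : AEMeasurable fun v => ENNReal.ofReal √(W v) := by fun_prop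
  calc ‖∫ v, F v * ψ v‖ₑ ≤ ∫⁻ v, ‖F v * ψ v‖ₑ := enorm_integral_le_lintegral_enorm _
    _ = ∫⁻ v, ((fun v => ‖F v‖ₑ / ENNReal.ofReal √(W v)) *
          fun v => ENNReal.ofReal √(W v) * ‖ψ v‖ₑ) v := by
        refine lintegral_congr_ae ?_
        filter_upwards [hpos] with v hv
        simp only [Pi.mul_apply]
        rw [enorm_mul, ← mul_assoc, ENNReal.div_mul_cancel _ ENNReal.ofReal_ne_top]
        simpa using hv
    _ ≤ _ := by
        refine (ENNReal.lintegral_mul_le_Lp_mul_Lq _ Real.HolderConjugate.two_two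
          (hF.enorm.div hm) (hm.mul hψ.enorm)).trans_eq ?_
        congr 2
        · refine lintegral_congr_ae ?_
          filter_upwards [hsq] with v hv
          rw [ENNReal.rpow_two, Pi.div_apply, div_eq_mul_inv, mul_pow, ← ENNReal.inv_pow, hv,
            div_eq_mul_inv]
        · refine lintegral_congr_ae ?_
          filter_upwards [hsq] with v hv
          rw [ENNReal.rpow_two, Pi.mul_apply, mul_pow, hv]

end Fourier

/-! ### The generalized Fourier transform of the multiquadric -/

theorem IsGeneralizedFourier.locallyIntegrableOn {h w : Rn n → ℝ} (hw : IsGeneralizedFourier h w) :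
    LocallyIntegrableOn w {0}ᶜ := by
  rw [locallyIntegrableOn_iff isOpen_compl_singleton.isLocallyClosed]
  intro K hK hKc
  have : IsFiniteMeasure (volume.restrict K) := ⟨by simpa using hKc.measure_lt_top⟩
  exact (hw.2.1 K hKc fun h0 => hK h0 rfl).integrable one_le_two

/-- A test function vanishing near the origin is admissible for every order `m`, so candidates with
different `m` can be compared on it. -/
theorem IsGeneralizedFourier.integral_smul_eq {h w : Rn n → ℝ} (hw : IsGeneralizedFourier h w)
    {g : Rn n → ℝ} {γ : 𝓢(Rn n, ℂ)} (hγ : ∀ ξ, γ ξ = (g ξ : ℂ)) (h0 : (0 : Rn n) ∉ tsupport g) :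
    Integrable (fun ξ => g ξ * w ξ) ∧
      ∫ x, (h x : ℂ) * angularFourier (fun ξ => γ ξ) x = ((∫ ξ, g ξ * w ξ : ℝ) : ℂ) := by
  obtain ⟨m, hm⟩ := hw.2.2
  have hzero : (fun ξ => γ ξ) =ᶠ[nhds 0] 0 := by
    filter_upwards [notMem_tsupport_iff_eventuallyEq.1 h0] with ξ hξ
    simp [hγ, hξ]
  obtain ⟨hint, heq⟩ := hm γ (hzero.trans_isBigO (Asymptotics.isBigO_zero _ _))
  have hcast : (fun ξ => (w ξ : ℂ) * γ ξ) = fun ξ => ((g ξ * w ξ : ℝ) : ℂ) := by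
    ext ξ
    rw [hγ]
    push_cast
    ring
  rw [hcast] at hint heq
  exact ⟨by simpa using hint.re, heq.trans integral_ofReal⟩

theorem IsGeneralizedFourier.ae_eq (hn : 1 ≤ n) {h w₁ w₂ : Rn n → ℝ}
    (h₁ : IsGeneralizedFourier h w₁) (h₂ : IsGeneralizedFourier h w₂) : w₁ =ᵐ[volume] w₂ := by
  have : Nonempty (Fin n) := ⟨⟨0, hn⟩⟩
  have key := isOpen_compl_singleton.ae_eq_zero_of_integral_contDiff_smul_eq_zero
    (h₁.locallyIntegrableOn.sub h₂.locallyIntegrableOn) fun g hg hgc hgs => by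
      have hg₁ : HasCompactSupport (Complex.ofRealCLM ∘ g) := hgc.comp_left rfl
      have hg₂ : ContDiff ℝ (⊤ : ℕ∞) (Complex.ofRealCLM ∘ g) := by fun_prop
      have hγ : ∀ ξ, hg₁.toSchwartzMap hg₂ ξ = (g ξ : ℂ) := fun ξ => rfl
      have h0 : (0 : Rn n) ∉ tsupport g := fun h => hgs h rfl
      obtain ⟨i₁, e₁⟩ := h₁.integral_smul_eq hγ h0
      obtain ⟨i₂, e₂⟩ := h₂.integral_smul_eq hγ h0
      simp only [smul_eq_mul, Pi.sub_apply, mul_sub]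
      rw [integral_sub i₁ i₂, sub_eq_zero]
      exact_mod_cast e₁.symm.trans e₂
  filter_upwards [key, Measure.ae_ne volume (0 : Rn n)] with ξ hξ hξ0
  exact sub_eq_zero.1 (hξ hξ0)

theorem integral_multiquadric_mul_angularFourier (hβ : β < 0) (hc : 0 < c) (γ : 𝓢(Rn n, ℂ)) :
    ∫ x, (multiquadric n β c x : ℂ) * angularFourier (fun ξ => γ ξ) x =
      ∫ ξ, (multiquadricFourier n β c ξ : ℂ) * γ ξ := by
  have hpi : (0 : ℝ) < 2 * Real.pi := by positivity
  have hang : ∀ x, angularFourier (fun ξ => γ ξ) x =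
      (((2 * Real.pi) ^ (-(n : ℝ) / 2) : ℝ) : ℂ) * 𝓕 (fun ξ => γ ξ) ((2 * Real.pi)⁻¹ • x) := by
    intro x
    rw [angularFourier, Real.fourier_eq']
    congr 1
    refine integral_congr_ae (Filter.Eventually.of_forall fun v => ?_)
    simp only [smul_eq_mul, inner_smul_right]
    congr 2
    push_cast
    field_simp
  have hconst : (2 * Real.pi) ^ n * (2 * Real.pi) ^ (-(n : ℝ) / 2) =
      (2 * Real.pi) ^ ((n : ℝ) / 2) := by
    rw [← Real.rpow_natCast, ← Real.rpow_add hpi]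
    ring_nf
  set H : Rn n → ℂ := fun y => (multiquadric n β c ((2 * Real.pi) • y) : ℂ) *
    ((((2 * Real.pi) ^ (-(n : ℝ) / 2) : ℝ) : ℂ) * 𝓕 (fun ξ => γ ξ) y) with hH
  calc ∫ x, (multiquadric n β c x : ℂ) * angularFourier (fun ξ => γ ξ) x
      = ∫ x, H ((2 * Real.pi)⁻¹ • x) := by
        refine integral_congr_ae (Filter.Eventually.of_forall fun x => ?_)
        simp only [hH, hang, smul_inv_smul₀ hpi.ne']
    _ = ∫ y, 𝓕⁻ (fun ξ : Rn n => (multiquadricFourier n β c ξ : ℂ)) y *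
          𝓕 (fun ξ => γ ξ) y := by
        rw [Measure.integral_comp_inv_smul_of_nonneg volume H hpi.le, finrank_euclideanSpace_fin,
          ← integral_smul]
        refine integral_congr_ae (Filter.Eventually.of_forall fun y => ?_)
        simp only [hH, fourierInv_multiquadricFourier hβ hc, ← hconst, Complex.real_smul]
        push_cast
        ring
    _ = _ := by
        have hinv : 𝓕⁻ (𝓕 (fun ξ => γ ξ)) = fun ξ => γ ξ := by
          rw [← SchwartzMap.fourier_coe, ← SchwartzMap.fourierInv_coe,
            FourierPair.fourierInv_fourier_eq]
        have hw : Integrable fun ξ : Rn n => (multiquadricFourier n β c ξ : ℂ) :=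
          (integrable_multiquadricFourier hβ hc).ofReal
        rw [integral_fourierInv_mul hw
          (by rw [← SchwartzMap.fourier_coe]; exact (𝓕 γ).integrable), hinv]

theorem isGeneralizedFourier_multiquadricFourier (hβ : β < 0) (hc : 0 < c) :
    IsGeneralizedFourier (multiquadric n β c) (multiquadricFourier n β c) :=
  -- Order `0` suffices: the transform is integrable, so `γ` need not vanish at the origin.
  ⟨measurable_multiquadricFourier, fun _ hK h0 => memLp_multiquadricFourier hβ hc hK h0, 0,
    fun γ _ => ⟨(integrable_multiquadricFourier hβ hc).ofReal.mul_bdd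
      γ.continuous.aestronglyMeasurable
      (Filter.Eventually.of_forall (SchwartzMap.norm_le_seminorm ℝ γ)),
      integral_multiquadric_mul_angularFourier hβ hc γ⟩⟩

theorem generalizedFourier_multiquadric_ae_eq (hn : 1 ≤ n) (hβ : β < 0) (hc : 0 < c) :
    generalizedFourier (multiquadric n β c) =ᵐ[volume] multiquadricFourier n β c := by
  have hex : ∃ w, IsGeneralizedFourier (multiquadric n β c) w :=
    ⟨_, isGeneralizedFourier_multiquadricFourier hβ hc⟩
  rw [generalizedFourier, dif_pos hex]
  exact hex.choose_spec.ae_eq hn (isGeneralizedFourier_multiquadricFourier hβ hc)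

/-! ### The bound of the `h`-norm -/

theorem multiquadricFourier_pos (hβ : β < 0) (hc : 0 < c) (hnβ : 1 ≤ |(n : ℝ) + β|) {ξ : Rn n}
    (hξ : ξ ≠ 0) : 0 < multiquadricFourier n β c ξ := by
  have : 0 < ‖ξ‖ := norm_pos_iff.2 hξ
  exact lt_of_lt_of_le (by positivity) (le_multiquadricFourier hβ hc hnβ hξ)

/-- The supremum of `exp (-|ξ|² / σ) / ĥ(ξ)`, up to the estimate of the Bessel function. -/
def gaussRatioBound (n : ℕ) (β c σ : ℝ) : ℝ :=
  2 ^ (-(1 + β) / 2) * Real.pi ^ (-(1 / 2) : ℝ) * c ^ ((1 - (n : ℝ) - β) / 2) *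
    (xiStar n β c σ ^ (((n : ℝ) + β + 1) / 2) *
      Real.exp (c * xiStar n β c σ - xiStar n β c σ ^ 2 / σ))

theorem gaussRatioBound_pos (hc : 0 < c) (hσ : 0 < σ) : 0 < gaussRatioBound n β c σ := by
  have := xiStar_pos (n := n) (β := β) hc hσ
  unfold gaussRatioBound
  positivity

/-- The pointwise form of the norm bound, cleared of denominators: the Bessel lower bound combined
with the maximum at `ξ*`. -/
theorem one_le_gaussRatioBound_mul (hβ : β < 0) (hc : 0 < c) (hσ : 0 < σ)
    (hnβ : 1 ≤ |(n : ℝ) + β|) (h : 0 ≤ (n : ℝ) + β + 1) {ξ : Rn n} (hξ : ξ ≠ 0) :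
    1 ≤ gaussRatioBound n β c σ * Real.exp (‖ξ‖ ^ 2 / σ) * multiquadricFourier n β c ξ := by
  have hr : 0 < ‖ξ‖ := norm_pos_iff.2 hξ
  have hB := gaussRatioBound_pos (n := n) (β := β) hc hσ
  have hmax := rpow_mul_exp_sub_sq_div_le (a := ((n : ℝ) + β + 1) / 2) (by linarith) hσ
    (xiStar_pos hc hσ) (two_mul_xiStar_sq (c := c) hσ h) hr.le
  have hlow := le_multiquadricFourier hβ hc hnβ hξ
  refine le_trans ?_ (mul_le_mul_of_nonneg_left hlow (by positivity))
  set r := ‖ξ‖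
  have e2 : (2 : ℝ) ^ (-(1 + β) / 2) * 2 ^ ((1 + β) / 2) = 1 := by
    rw [← Real.rpow_add two_pos, neg_div, neg_add_cancel, Real.rpow_zero]
  have ep : Real.pi ^ (-(1 / 2) : ℝ) * √Real.pi = 1 := by
    rw [Real.sqrt_eq_rpow, ← Real.rpow_add Real.pi_pos, neg_add_cancel, Real.rpow_zero]
  have ec : c ^ ((1 - (n : ℝ) - β) / 2) * c ^ (((n : ℝ) + β - 1) / 2) = 1 := by
    rw [← Real.rpow_add hc, ← Real.rpow_zero c]; ring_nf
  have er : r ^ (((n : ℝ) + β + 1) / 2) * r ^ (-((n : ℝ) + β + 1) / 2) = 1 := by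
    rw [← Real.rpow_add hr, neg_div, add_neg_cancel, Real.rpow_zero]
  have ee : Real.exp (c * r - r ^ 2 / σ) * (Real.exp (r ^ 2 / σ) * Real.exp (-(c * r))) = 1 := by
    rw [← Real.exp_add, ← Real.exp_add, ← Real.exp_zero]; ring_nf
  set M := xiStar n β c σ ^ (((n : ℝ) + β + 1) / 2) *
      Real.exp (c * xiStar n β c σ - xiStar n β c σ ^ 2 / σ) with hM
  calc (1 : ℝ) = r ^ (((n : ℝ) + β + 1) / 2) * Real.exp (c * r - r ^ 2 / σ) *
        (r ^ (-((n : ℝ) + β + 1) / 2) * (Real.exp (r ^ 2 / σ) * Real.exp (-(c * r)))) := by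
        rw [mul_mul_mul_comm, er, ee, one_mul]
    _ ≤ M * (r ^ (-((n : ℝ) + β + 1) / 2) * (Real.exp (r ^ 2 / σ) * Real.exp (-(c * r)))) := by
        gcongr
    _ = ((2 : ℝ) ^ (-(1 + β) / 2) * 2 ^ ((1 + β) / 2)) * (Real.pi ^ (-(1 / 2) : ℝ) * √Real.pi) *
        (c ^ ((1 - (n : ℝ) - β) / 2) * c ^ (((n : ℝ) + β - 1) / 2)) *
        (M * (r ^ (-((n : ℝ) + β + 1) / 2) * (Real.exp (r ^ 2 / σ) * Real.exp (-(c * r))))) := by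
        rw [e2, ep, ec, one_mul, one_mul, one_mul]
    _ = _ := by
        rw [gaussRatioBound, ← hM]
        ring

theorem lintegral_div_multiquadricFourier_le (hn : 1 ≤ n) (hβ : β < 0) (hc : 0 < c) (hσ : 0 < σ)
    (hnβ : 1 ≤ |(n : ℝ) + β|) (h : 0 ≤ (n : ℝ) + β + 1) (g : Rn n → ℂ) :
    ∫⁻ ξ, ‖g ξ‖ₑ ^ 2 / ENNReal.ofReal (multiquadricFourier n β c ξ) ≤
      ENNReal.ofReal (gaussRatioBound n β c σ) *
        ∫⁻ ξ, ‖g ξ‖ₑ ^ 2 * ENNReal.ofReal (Real.exp (‖ξ‖ ^ 2 / σ)) := by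
  have : Nonempty (Fin n) := ⟨⟨0, hn⟩⟩
  have hB := gaussRatioBound_pos (n := n) (β := β) hc hσ
  rw [← lintegral_const_mul' _ _ ENNReal.ofReal_ne_top]
  refine lintegral_mono_ae ?_
  filter_upwards [Measure.ae_ne volume (0 : Rn n)] with ξ hξ
  refine ENNReal.div_le_of_le_mul ?_
  have h1 := ENNReal.ofReal_le_ofReal (one_le_gaussRatioBound_mul hβ hc hσ hnβ h hξ)
  rw [ENNReal.ofReal_mul (by positivity), ENNReal.ofReal_mul hB.le, ENNReal.ofReal_one] at h1
  calc ‖g ξ‖ₑ ^ 2 = ‖g ξ‖ₑ ^ 2 * 1 := (mul_one _).symm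
    _ ≤ ‖g ξ‖ₑ ^ 2 * _ := mul_le_mul_right h1 _
    _ = _ := by ring

theorem sqrt_gaussRatioBound (hc : 0 < c) (hσ : 0 < σ) :
    (((2 * Real.pi) ^ (2 * n))⁻¹ * gaussRatioBound n β c σ) ^ (1 / 2 : ℝ) =
      (2 : ℝ) ^ (-(n : ℝ) - (1 + β) / 4) * Real.pi ^ (-(n : ℝ) - 1 / 4) *
          c ^ ((1 - (n : ℝ) - β) / 4) *
          (xiStar n β c σ ^ (((n : ℝ) + β + 1) / 2) *
            Real.exp (c * xiStar n β c σ - xiStar n β c σ ^ 2 / σ)) ^ (1 / 2 : ℝ) := by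
  have hX := xiStar_pos (n := n) (β := β) hc hσ
  have hpi := Real.pi_pos
  have h1 : ((2 * Real.pi) ^ (2 * n))⁻¹ = 2 ^ (-(2 * n) : ℝ) * Real.pi ^ (-(2 * n) : ℝ) := by
    rw [← Real.mul_rpow two_pos.le hpi.le, Real.rpow_neg (by positivity)]
    norm_cast
  rw [gaussRatioBound, h1]
  set M := xiStar n β c σ ^ (((n : ℝ) + β + 1) / 2) *
      Real.exp (c * xiStar n β c σ - xiStar n β c σ ^ 2 / σ) with hM
  have hM0 : 0 ≤ M := by positivity
  have h2 : 2 ^ (-(2 * n) : ℝ) * Real.pi ^ (-(2 * n) : ℝ) * (2 ^ (-(1 + β) / 2) *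
      Real.pi ^ (-(1 / 2) : ℝ) * c ^ ((1 - (n : ℝ) - β) / 2) * M) =
      2 ^ (-(2 * n) + -(1 + β) / 2 : ℝ) * Real.pi ^ (-(2 * n) + -(1 / 2) : ℝ) *
        c ^ ((1 - (n : ℝ) - β) / 2) * M := by
    rw [Real.rpow_add two_pos, Real.rpow_add hpi]
    ring
  rw [h2, Real.mul_rpow (by positivity) hM0, Real.mul_rpow (by positivity) (by positivity),
    Real.mul_rpow (by positivity) (by positivity), ← Real.rpow_mul two_pos.le,
    ← Real.rpow_mul hpi.le, ← Real.rpow_mul hc.le]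
  ring_nf

theorem hNorm_multiquadric_le (hn : 1 ≤ n) (hβ : β < 0) (hc : 0 < c) (hσ : 0 < σ)
    (hnβ : 1 ≤ |(n : ℝ) + β|) (h : 0 ≤ (n : ℝ) + β + 1)
    (f : Lp ℂ 2 (volume : Measure (Rn n))) :
    hNorm (multiquadric n β c) f ≤
      ENNReal.ofReal ((((2 * Real.pi) ^ (2 * n))⁻¹ * gaussRatioBound n β c σ) ^ (1 / 2 : ℝ)) *
        gaussNorm σ f := by
  have hB := gaussRatioBound_pos (n := n) (β := β) hc hσ
  have hgen : ∫⁻ ξ, ‖angularFourierL2 f ξ‖ₑ ^ 2 /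
        ENNReal.ofReal (generalizedFourier (multiquadric n β c) ξ) =
      ∫⁻ ξ, ‖angularFourierL2 f ξ‖ₑ ^ 2 / ENNReal.ofReal (multiquadricFourier n β c ξ) := by
    refine lintegral_congr_ae ?_
    filter_upwards [generalizedFourier_multiquadric_ae_eq hn hβ hc] with ξ hξ
    rw [hξ]
  rw [hNorm, gaussNorm, hgen, ← ENNReal.ofReal_rpow_of_nonneg (by positivity) (by norm_num),
    ← ENNReal.mul_rpow_of_nonneg _ _ (by norm_num), ENNReal.ofReal_mul (by positivity), mul_assoc]
  gcongr
  exact lintegral_div_multiquadricFourier_le hn hβ hc hσ hnβ h _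

/-! ### Membership in the native space -/

theorem integrable_of_lintegral_gauss {b : ℝ} (hb : 0 < b) {F : Rn n → ℂ}
    (hF : AEStronglyMeasurable F)
    (hfin : ∫⁻ v, ‖F v‖ₑ ^ 2 * ENNReal.ofReal (Real.exp (b * ‖v‖ ^ 2)) < ⊤) : Integrable F := by
  have h1 : Integrable fun v => ‖F v‖ ^ 2 * Real.exp (b * ‖v‖ ^ 2) := by
    refine ⟨(hF.norm.pow 2).mul (by fun_prop), ?_⟩
    refine lt_of_eq_of_lt (lintegral_congr fun v => ?_) hfin
    rw [enorm_mul, enorm_pow, enorm_norm, Real.enorm_of_nonneg (Real.exp_pos _).le]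
  have h2 : Integrable fun v : Rn n => Real.exp (-b * ‖v‖ ^ 2) := by
    have := GaussianFourier.integrable_cexp_neg_mul_sq_norm_add (V := Rn n)
      (b := (b : ℂ)) (by simpa using hb) 0 0
    refine this.norm.congr (Filter.Eventually.of_forall fun v => ?_)
    simp only [Complex.norm_exp]
    norm_cast
    simp
  refine (h1.add h2).mono' hF (Filter.Eventually.of_forall fun v => ?_)
  have hE := Real.exp_pos (b * ‖v‖ ^ 2)
  simp only [Pi.add_apply, neg_mul, Real.exp_neg]
  set E := Real.exp (b * ‖v‖ ^ 2)
  -- Completing the square gives `‖F‖ ≤ ‖F‖² E + E⁻¹`, and both terms on the right are integrable.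
  have : ‖F v‖ ^ 2 * E + E⁻¹ - ‖F v‖ = E⁻¹ * ((‖F v‖ * E - 1 / 2) ^ 2 + 3 / 4) := by
    field_simp
    ring
  have h0 : 0 ≤ E⁻¹ * ((‖F v‖ * E - 1 / 2) ^ 2 + 3 / 4) := by positivity
  linarith

/-- The Fourier transform of the multiquadric for the normalization of `𝓕`. -/
def unitFrequencyFourier (n : ℕ) (β c : ℝ) (v : Rn n) : ℝ :=
  (2 * Real.pi) ^ ((n : ℝ) / 2) * multiquadricFourier n β c ((2 * Real.pi) • v)

theorem integrable_unitFrequencyFourier (hβ : β < 0) (hc : 0 < c) :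
    Integrable (unitFrequencyFourier n β c) :=
  ((integrable_multiquadricFourier hβ hc).comp_smul (by positivity)).const_mul _

theorem measurable_unitFrequencyFourier : Measurable (unitFrequencyFourier n β c) :=
  (measurable_multiquadricFourier.comp (measurable_const_smul _)).const_mul _

theorem unitFrequencyFourier_nonneg (v : Rn n) : 0 ≤ unitFrequencyFourier n β c v :=
  mul_nonneg (by positivity) (multiquadricFourier_nonneg _)

theorem fourierInv_unitFrequencyFourier (hβ : β < 0) (hc : 0 < c) (x : Rn n) :
    𝓕⁻ (fun v : Rn n => (unitFrequencyFourier n β c v : ℂ)) x = (multiquadric n β c x : ℂ) := by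
  have hpi : (0 : ℝ) < 2 * Real.pi := by positivity
  have h := fourierInv_multiquadricFourier hβ hc ((2 * Real.pi)⁻¹ • x)
  rw [smul_inv_smul₀ hpi.ne', Real.fourierInv_eq] at h
  set H : Rn n → ℂ := fun ξ => Real.fourierChar ⟪ξ, (2 * Real.pi)⁻¹ • x⟫ •
    (multiquadricFourier n β c ξ : ℂ) with hH
  have hconst : ((2 * Real.pi) ^ n)⁻¹ * (2 * Real.pi) ^ ((n : ℝ) / 2) *
      (2 * Real.pi) ^ ((n : ℝ) / 2) = 1 := by
    rw [mul_assoc, ← Real.rpow_add hpi, add_halves, Real.rpow_natCast,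
      inv_mul_cancel₀ (by positivity)]
  calc 𝓕⁻ (fun v : Rn n => (unitFrequencyFourier n β c v : ℂ)) x
      = (((2 * Real.pi) ^ ((n : ℝ) / 2) : ℝ) : ℂ) * ∫ v, H ((2 * Real.pi) • v) := by
        rw [Real.fourierInv_eq, ← integral_const_mul]
        refine integral_congr_ae (Filter.Eventually.of_forall fun v => ?_)
        have hv : ⟪(2 * Real.pi) • v, (2 * Real.pi)⁻¹ • x⟫ = ⟪v, x⟫ := by
          rw [real_inner_smul_left, real_inner_smul_right, mul_inv_cancel_left₀ hpi.ne']
        simp only [hH, hv, unitFrequencyFourier, Circle.smul_def, smul_eq_mul]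
        push_cast
        ring
    _ = _ := by
        rw [Measure.integral_comp_smul_of_nonneg volume H _ (hR := hpi.le), h,
          finrank_euclideanSpace_fin, Complex.real_smul, ← Complex.ofReal_mul,
          ← Complex.ofReal_mul]
        congr 1
        linear_combination multiquadric n β c x * hconst

/-- Parseval for the kernel form, which is thereby real and nonnegative. -/
theorem lintegral_unitFrequencyFourier_mul (hβ : β < 0) (hc : 0 < c) {φ : Rn n → ℂ}
    (hφ : Integrable φ) :
    ∫⁻ v, ENNReal.ofReal (unitFrequencyFourier n β c v) * ‖𝓕⁻ φ v‖ₑ ^ 2 =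
      ENNReal.ofReal (kernelForm (multiquadric n β c) φ).re := by
  have hW : Integrable fun v : Rn n => (unitFrequencyFourier n β c v : ℂ) :=
    (integrable_unitFrequencyFourier hβ hc).ofReal
  have hint : Integrable fun v => unitFrequencyFourier n β c v * ‖𝓕⁻ φ v‖ ^ 2 := by
    refine (integrable_unitFrequencyFourier hβ hc).mul_bdd (c := (∫ x, ‖φ x‖) ^ 2)
      ((continuous_fourierInv hφ).norm.pow 2).aestronglyMeasurable
      (Filter.Eventually.of_forall fun v => ?_)
    rw [norm_pow, norm_norm]
    exact pow_le_pow_left₀ (norm_nonneg _) (norm_fourierInv_le φ v) 2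
  have hform : kernelForm (multiquadric n β c) φ =
      ((∫ v, unitFrequencyFourier n β c v * ‖𝓕⁻ φ v‖ ^ 2 : ℝ) : ℂ) := by
    unfold kernelForm
    simp_rw [← fourierInv_unitFrequencyFourier hβ hc]
    rw [integral_integral_fourierInv_sub hW hφ]
    simp_rw [← Complex.ofReal_mul]
    exact integral_ofReal
  rw [hform, Complex.ofReal_re, ofReal_integral_eq_lintegral_ofReal hint
    (Filter.Eventually.of_forall fun v =>
      mul_nonneg (unitFrequencyFourier_nonneg v) (by positivity))]
  refine lintegral_congr fun v => ?_
  rw [ENNReal.ofReal_mul (unitFrequencyFourier_nonneg v), ENNReal.ofReal_pow (norm_nonneg _),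
    ofReal_norm]

theorem lintegral_fourier_gauss_lt_top {f : Lp ℂ 2 (volume : Measure (Rn n))}
    (hf : f ∈ gaussSpace n σ) :
    ∫⁻ ξ, ‖((𝓕 f : Lp ℂ 2 (volume : Measure (Rn n))) : Rn n → ℂ) ((2 * Real.pi)⁻¹ • ξ)‖ₑ ^ 2 *
      ENNReal.ofReal (Real.exp (‖ξ‖ ^ 2 / σ)) < ⊤ := by
  have hκ : (((2 * Real.pi) ^ (-(n : ℝ) / 2) : ℝ) : ℂ) ≠ 0 :=
    Complex.ofReal_ne_zero.2 (by positivity)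
  set κ := (((2 * Real.pi) ^ (-(n : ℝ) / 2) : ℝ) : ℂ) with hκdef
  have heq : ∀ ξ, ‖((𝓕 f : Lp ℂ 2 (volume : Measure (Rn n))) : Rn n → ℂ)
        ((2 * Real.pi)⁻¹ • ξ)‖ₑ ^ 2 * ENNReal.ofReal (Real.exp (‖ξ‖ ^ 2 / σ)) =
      ‖κ⁻¹‖ₑ ^ 2 *
        (‖angularFourierL2 f ξ‖ₑ ^ 2 * ENNReal.ofReal (Real.exp (‖ξ‖ ^ 2 / σ))) := by
    intro ξ
    rw [← mul_assoc, ← mul_pow, ← enorm_mul, angularFourierL2, inv_mul_cancel_left₀ hκ]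
  simp_rw [heq]
  rw [lintegral_const_mul' _ _ (by simp)]
  exact ENNReal.mul_lt_top (by simp) hf

theorem exists_mem_nativeSpace_multiquadric (hn : 1 ≤ n) (hβ : β < 0) (hc : 0 < c) (hσ : 0 < σ)
    (hnβ : 1 ≤ |(n : ℝ) + β|) (h : 0 ≤ (n : ℝ) + β + 1) (m : ℕ)
    {f : Lp ℂ 2 (volume : Measure (Rn n))} (hf : f ∈ gaussSpace n σ) :
    ∃ g ∈ nativeSpace (multiquadric n β c) m, (f : Rn n → ℂ) =ᵐ[volume] g := by
  have : Nonempty (Fin n) := ⟨⟨0, hn⟩⟩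
  have hpi : (0 : ℝ) < 2 * Real.pi := by positivity
  set F : Rn n → ℂ := ((𝓕 f : Lp ℂ 2 (volume : Measure (Rn n))) : Rn n → ℂ) with hFdef
  have hFm : AEStronglyMeasurable F := Lp.aestronglyMeasurable _
  have hgauss := lintegral_fourier_gauss_lt_top hf
  rw [← hFdef] at hgauss
  have hweight := (lintegral_div_multiquadricFourier_le hn hβ hc hσ hnβ h
    (fun ξ => F ((2 * Real.pi)⁻¹ • ξ))).trans_lt (ENNReal.mul_lt_top ENNReal.ofReal_lt_top hgauss)
  have hscale : ∀ φ : Rn n → ℝ≥0∞, ∫⁻ ξ, φ ξ < ⊤ → ∫⁻ v, φ ((2 * Real.pi) • v) < ⊤ := by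
    intro φ hφ
    rw [lintegral_comp_smul φ hpi.ne']
    exact ENNReal.mul_lt_top ENNReal.ofReal_lt_top hφ
  have hFint : Integrable F := by
    refine integrable_of_lintegral_gauss (b := (2 * Real.pi) ^ 2 / σ) (by positivity) hFm ?_
    refine lt_of_eq_of_lt (lintegral_congr fun v => ?_) (hscale _ hgauss)
    rw [inv_smul_smul₀ hpi.ne', norm_smul, Real.norm_of_nonneg hpi.le, mul_pow _ ‖v‖,
      div_mul_eq_mul_div]
  have hD : ∫⁻ v, ‖F v‖ₑ ^ 2 / ENNReal.ofReal (unitFrequencyFourier n β c v) < ⊤ := by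
    have hk : ENNReal.ofReal ((2 * Real.pi) ^ ((n : ℝ) / 2)) ≠ 0 := by
      simpa using Real.rpow_pos_of_pos hpi _
    have heq : ∀ v, ‖F v‖ₑ ^ 2 / ENNReal.ofReal (unitFrequencyFourier n β c v) =
        (ENNReal.ofReal ((2 * Real.pi) ^ ((n : ℝ) / 2)))⁻¹ *
          (‖F v‖ₑ ^ 2 / ENNReal.ofReal (multiquadricFourier n β c ((2 * Real.pi) • v))) := by
      intro v
      rw [unitFrequencyFourier, ENNReal.ofReal_mul (by positivity), ENNReal.div_eq_inv_mul,
        ENNReal.mul_inv (Or.inl hk) (Or.inl ENNReal.ofReal_ne_top), ENNReal.div_eq_inv_mul,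
        mul_assoc]
    simp_rw [heq]
    rw [lintegral_const_mul' _ _ (ENNReal.inv_ne_top.2 hk)]
    refine ENNReal.mul_lt_top (ENNReal.inv_lt_top.2 (pos_iff_ne_zero.2 hk)) ?_
    refine lt_of_eq_of_lt (lintegral_congr fun v => ?_) (hscale _ hweight)
    rw [inv_smul_smul₀ hpi.ne']
  have hpos : ∀ᵐ v : Rn n, 0 < unitFrequencyFourier n β c v := by
    filter_upwards [Measure.ae_ne volume (0 : Rn n)] with v hv
    exact mul_pos (by positivity)
      (multiquadricFourier_pos hβ hc hnβ (smul_ne_zero hpi.ne' hv))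
  -- The constant is the norm of `F` in `L²` with weight the reciprocal of `unitFrequencyFourier`;
  -- `hD` makes it finite, so `toReal` loses nothing.
  refine ⟨𝓕⁻ F, ⟨continuous_fourierInv hFint,
    ((∫⁻ v, ‖F v‖ₑ ^ 2 / ENNReal.ofReal (unitFrequencyFourier n β c v)) ^ (1 / 2 : ℝ)).toReal,
    fun φ hφ => ?_⟩, ae_eq_fourierInv_of_integrable_fourier f hFint⟩
  have hφint : Integrable φ := hφ.1.continuous.integrable_of_hasCompactSupport hφ.2.1
  have hcs := enorm_integral_mul_le_of_weight hFm
    (continuous_fourierInv hφint).aestronglyMeasurable measurable_unitFrequencyFourier hpos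
  rw [lintegral_unitFrequencyFourier_mul hβ hc hφint, ← integral_fourierInv_mul hFint hφint] at hcs
  have hfin :
      (∫⁻ v, ‖F v‖ₑ ^ 2 / ENNReal.ofReal (unitFrequencyFourier n β c v)) ^ (1 / 2 : ℝ) ≠ ⊤ :=
    ENNReal.rpow_ne_top_of_nonneg (by norm_num) hD.ne
  have hsqrt : ENNReal.ofReal (kernelForm (multiquadric n β c) φ).re ^ (1 / 2 : ℝ) =
      ENNReal.ofReal √(kernelForm (multiquadric n β c) φ).re := by
    rcases le_total 0 (kernelForm (multiquadric n β c) φ).re with hk | hk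
    · rw [Real.sqrt_eq_rpow, ENNReal.ofReal_rpow_of_nonneg hk (by norm_num)]
    · rw [Real.sqrt_eq_zero_of_nonpos hk, ENNReal.ofReal_of_nonpos hk, ENNReal.ofReal_zero,
        ENNReal.zero_rpow_of_pos (by norm_num)]
  rw [hsqrt] at hcs
  have := ENNReal.toReal_mono (ENNReal.mul_ne_top hfin ENNReal.ofReal_ne_top) hcs
  rwa [ENNReal.toReal_mul, ENNReal.toReal_ofReal (Real.sqrt_nonneg _), toReal_enorm] at this

end ShapeParameter

end

theorem theorem2p2 (n : ℕ) (hn : 1 ≤ n) (β c σ : ℝ) (hβ : β < 0) (hc : 0 < c) (hσ : 0 < σ)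
    (h1 : 1 ≤ |(n : ℝ) + β|) (h2 : 0 ≤ (n : ℝ) + β + 1)
    (f : MeasureTheory.Lp ℂ 2 (MeasureTheory.volume : MeasureTheory.Measure (ShapeParameter.Rn n)))
    (hf : f ∈ ShapeParameter.gaussSpace n σ) :
    (∃ g ∈ ShapeParameter.nativeSpace (ShapeParameter.multiquadric n β c)
        (ShapeParameter.cpdOrder β), (f : ShapeParameter.Rn n → ℂ) =ᵐ[MeasureTheory.volume] g) ∧
    ShapeParameter.hNorm (ShapeParameter.multiquadric n β c) f ≤
      ENNReal.ofReal
        ((2 : ℝ) ^ (-(n : ℝ) - (1 + β) / 4) * Real.pi ^ (-(n : ℝ) - 1 / 4) *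
          c ^ ((1 - (n : ℝ) - β) / 4) *
          (ShapeParameter.xiStar n β c σ ^ (((n : ℝ) + β + 1) / 2) *
            Real.exp (c * ShapeParameter.xiStar n β c σ
              - ShapeParameter.xiStar n β c σ ^ 2 / σ)) ^ (1 / 2 : ℝ)) *
        ShapeParameter.gaussNorm σ f := by
  refine ⟨ShapeParameter.exists_mem_nativeSpace_multiquadric hn hβ hc hσ h1 h2 _ hf, ?_⟩
  rw [← ShapeParameter.sqrt_gaussRatioBound hc hσ]
  exact ShapeParameter.hNorm_multiquadric_le hn hβ hc hσ h1 h2 f
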